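/- Let $0<\beta\le 1$ and let $E_\beta(z)=\sum_{n\ge 0} z^n/\Gamma(\beta n+1)$ be the Mittag-Leffler function. Let $\mu_\beta$ be the Mittag-Leffler measure on the space $\mathcal S'(\mathbb R)$ of real tempered distributions, i.e. the unique probability measure on the $\sigma$-algebra generated by the cylinder sets with $$\int_{\mathcal S'(\mathbb R)} e^{i\langle\omega,\varphi\rangle}\,d\mu_\beta(\omega)=E_\beta\big(-\tfrac12\langle\varphi,\varphi\rangle\big),\qquad \varphi\in\mathcal S(\mathbb R),$$ where $\langle\varphi,\psi\rangle=\int_{\mathbb R}\varphi\psi\,dx$ for real Schwartz functions. For $d\in\mathbb N$ let $\mathcal S_d(\mathbb R)$ be the direct sum of $d$ copies of $\mathcal S(\mathbb R)$, with scalar product $\langle\varphi,\psi\rangle=\sum_{k=1}^d\langle\varphi_k,\psi_k\rangle$ and norm $|\varphi|_0=\langle\varphi,\varphi\rangle^{1/2}$. Let $\mathcal S_d'(\mathbb R)$ be its dual, identified with $\mathcal S'(\mathbb R)^d$ through $\langle\omega,\varphi\rangle=\sum_{k=1}^d\langle\omega_k,\varphi_k\rangle$, and let $\mu_\beta^{\otimes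 d}$ be the $d$-fold product measure of $\mu_\beta$ on $\mathcal S_d'(\mathbb R)$. Then, for all $\varphi\in\mathcal S_d(\mathbb R)$ and all integers $n\ge 0$, every power of $\langle\cdot,\varphi\rangle$ is $\mu_\beta^{\otimes d}$-integrable and $$\int_{\mathcal S_d'(\mathbb R)}\langle\omega,\varphi\rangle^{2n+1}\,d\mu_\beta^{\otimes d}(\omega)=0,$$ $$\int_{\mathcal S_d'(\mathbb R)}\langle\omega,\varphi\rangle^{2n}\,d\mu_\beta^{\otimes d}(\omega)=\frac{(2n)!}{2^n}\sum_{r}\frac{\langle\varphi_1,\varphi_1\rangle^{r_1}\cdots\langle\varphi_d,\varphi_d\rangle^{r_d}}{\Gamma(\beta r_1+1)\cdots\Gamma(\beta r_d+1)},$$ where the sum is over all $r=(r_1,\dots,r_d)\in\mathbb N_0^d$ with $r_1+\cdots+r_d=n$, and $\langle\varphi_k,\varphi_k\rangle^0=1$ even if $\varphi_k=0$. In particular, for all $\varphi,\psi\in\mathcal S_d(\mathbb R)$, $$\|\langle\cdot,\varphi\rangle\|_{L^2(\mu_\beta^{\otimes d})}^2=\frac{1}{\Gamma(\beta+1)}|\varphi|_0^2,\qquad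 \int_{\mathcal S_d'(\mathbb R)}\langle\omega,\varphi\rangle\langle\omega,\psi\rangle\,d\mu_\beta^{\otimes d}(\omega)=\frac{1}{\Gamma(\beta+1)}\langle\varphi,\psi\rangle.$$ -/

import Mathlib

open MeasureTheory
open scoped SchwartzMap

noncomputable section

namespace MittagLeffler

/-- The Mittag-Leffler function `E_β(z) = ∑ zⁿ / Γ(β n + 1)` (an everywhere absolutely convergent
power series when `β > 0`). -/
def mittagLefflerE (β : ℝ) (z : ℂ) : ℂ :=
  ∑' n : ℕ, z ^ n / ((Real.Gamma (β * n + 1) : ℝ) : ℂ)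

/-- The space `𝒮_d(ℝ)`, the direct sum of `d` copies of the real Schwartz space `𝒮(ℝ)`
(with finitely many summands, the direct sum topology is the product topology). -/
abbrev SchwartzVec (d : ℕ) : Type := Fin d → 𝓢(ℝ, ℝ)

/-- The σ-algebra on the dual of `N` generated by the cylinder sets, i.e. the smallest one for which
all evaluations `ω ↦ ⟨ω, φ⟩` are Borel measurable. -/
@[reducible] def cylinderSigma (N : Type) [AddCommGroup N] [Module ℝ N] [TopologicalSpace N] :
    MeasurableSpace (StrongDual ℝ N) :=
  ⨆ φ : N, MeasurableSpace.comap (fun ω : StrongDual ℝ N => ω φ) (borel ℝ)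

instance instMeasurableSpaceDual : MeasurableSpace (StrongDual ℝ 𝓢(ℝ, ℝ)) :=
  cylinderSigma 𝓢(ℝ, ℝ)

instance instMeasurableSpaceDualVec (d : ℕ) : MeasurableSpace (StrongDual ℝ (SchwartzVec d)) :=
  cylinderSigma (SchwartzVec d)

/-- The `L²(ℝ)` scalar product `⟨f, g⟩` of two real Schwartz functions. -/
def l2Inner (f g : 𝓢(ℝ, ℝ)) : ℝ := ∫ x, f x * g x

/-- The `L²(ℝ; ℝ^d)` scalar product `⟨φ, ψ⟩` on `𝒮_d(ℝ)`. -/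
def l2InnerVec {d : ℕ} (φ ψ : SchwartzVec d) : ℝ := ∑ k, l2Inner (φ k) (ψ k)

/-- The `L²(ℝ; ℝ^d)` norm `|φ|₀` on `𝒮_d(ℝ)`. -/
def l2NormVec {d : ℕ} (φ : SchwartzVec d) : ℝ := √(l2InnerVec φ φ)

/-- `μ` is the Mittag-Leffler measure `μ_β` on `𝒮'(ℝ)`: the probability measure on the cylinder
σ-algebra whose characteristic function is `φ ↦ E_β(-⟨φ, φ⟩ / 2)`. -/
structure IsMittagLefflerMeasure (β : ℝ) (μ : Measure (StrongDual ℝ 𝓢(ℝ, ℝ))) : Prop where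
  isProbabilityMeasure : IsProbabilityMeasure μ
  charFun_eq : ∀ φ : 𝓢(ℝ, ℝ),
    ∫ ω, Complex.exp (Complex.I * ((ω φ : ℝ) : ℂ)) ∂μ
      = mittagLefflerE β ((-(1 / 2) * l2Inner φ φ : ℝ) : ℂ)

/-- The canonical identification `𝒮'(ℝ)^d → 𝒮_d'(ℝ)`,
`(ω₁, …, ω_d) ↦ (φ ↦ ∑ ⟨ω_k, φ_k⟩)`. -/
def dualOfTuple {d : ℕ} (ω : Fin d → StrongDual ℝ 𝓢(ℝ, ℝ)) : StrongDual ℝ (SchwartzVec d) :=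
  ∑ k, (ω k).comp (ContinuousLinearMap.proj (R := ℝ) (φ := fun _ : Fin d => 𝓢(ℝ, ℝ)) k)

/-- The `d`-fold product `μ^{⊗d}`, as a measure on `𝒮_d'(ℝ)`. -/
def productMeasure (μ : Measure (StrongDual ℝ 𝓢(ℝ, ℝ))) (d : ℕ) :
    Measure (StrongDual ℝ (SchwartzVec d)) :=
  (Measure.pi fun _ : Fin d => μ).map dualOfTuple

theorem dualOfTuple_apply {d : ℕ} (ω : Fin d → StrongDual ℝ 𝓢(ℝ, ℝ)) (φ : SchwartzVec d) :
    dualOfTuple ω φ = ∑ k, ω k (φ k) := by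
  simp [dualOfTuple]

theorem measurable_dual_apply (φ : 𝓢(ℝ, ℝ)) :
    Measurable fun ω : StrongDual ℝ 𝓢(ℝ, ℝ) => ω φ := by
  rw [BorelSpace.measurable_eq (α := ℝ)]
  exact (comap_measurable _).mono (le_iSup (fun φ : 𝓢(ℝ, ℝ) =>
    MeasurableSpace.comap (fun ω : StrongDual ℝ 𝓢(ℝ, ℝ) => ω φ) (borel ℝ)) φ) le_rfl

/-- The identification is measurable, so that the push-forward in `productMeasure` is the honest
one. -/
theorem measurable_dualOfTuple {d : ℕ} :
    Measurable (dualOfTuple : (Fin d → StrongDual ℝ 𝓢(ℝ, ℝ)) → StrongDual ℝ (SchwartzVec d)) := by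
  rw [measurable_iff_comap_le]
  change MeasurableSpace.comap dualOfTuple (cylinderSigma _) ≤ _
  rw [cylinderSigma, MeasurableSpace.comap_iSup]
  refine iSup_le fun φ => ?_
  rw [MeasurableSpace.comap_comp, ← BorelSpace.measurable_eq (α := ℝ), ← measurable_iff_comap_le]
  have h : (fun ω : StrongDual ℝ (SchwartzVec d) => ω φ) ∘ dualOfTuple
      = fun ω : Fin d → StrongDual ℝ 𝓢(ℝ, ℝ) => ∑ k, ω k (φ k) :=
    funext fun ω => dualOfTuple_apply ω φ
  rw [h]
  exact Finset.measurable_sum _ fun k _ =>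
    (measurable_dual_apply (φ k)).comp (measurable_pi_apply k)

/-- A Mittag-Leffler measure of given parameter is unique. -/
theorem IsMittagLefflerMeasure.unique {β : ℝ} {μ ν : Measure (StrongDual ℝ 𝓢(ℝ, ℝ))}
    (hμ : IsMittagLefflerMeasure β μ) (hν : IsMittagLefflerMeasure β ν) : μ = ν := by
  have := hμ.isProbabilityMeasure
  have := hν.isProbabilityMeasure
  let T : StrongDual ℝ 𝓢(ℝ, ℝ) → (𝓢(ℝ, ℝ) → ℝ) := fun ω φ => ω φ
  have hT : Measurable T := measurable_pi_iff.2 measurable_dual_apply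
  have hfin : ∀ (κ : Measure (StrongDual ℝ 𝓢(ℝ, ℝ))), IsMittagLefflerMeasure β κ →
      ∀ (I : Finset 𝓢(ℝ, ℝ)) (t : EuclideanSpace ℝ I),
      charFun (κ.map fun ω => WithLp.toLp 2 fun i : I => ω i) t
        = mittagLefflerE β
          ((-(1 / 2) * l2Inner (∑ i : I, t i • (i : 𝓢(ℝ, ℝ))) (∑ i : I, t i • (i : 𝓢(ℝ, ℝ))) : ℝ)
            : ℂ) := by
    intro κ hκ I t
    have hm : Measurable fun ω : StrongDual ℝ 𝓢(ℝ, ℝ) =>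
        (WithLp.toLp 2 fun i : I => ω i : EuclideanSpace ℝ I) :=
      (WithLp.measurable_toLp 2 _).comp (measurable_pi_iff.2 fun i => measurable_dual_apply _)
    rw [charFun_apply, integral_map hm.aemeasurable (by fun_prop), ← hκ.charFun_eq]
    refine integral_congr_ae (Filter.Eventually.of_forall fun ω => ?_)
    simp [PiLp.inner_apply, mul_comm]
  have hmap : μ.map T = ν.map T := by
    have := Measure.isProbabilityMeasure_map (μ := μ) hT.aemeasurable
    refine IsProjectiveLimit.unique (P := fun I : Finset 𝓢(ℝ, ℝ) => (μ.map T).map I.restrict)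
      (fun I => rfl) fun I => ?_
    have hr : Measurable (I.restrict (π := fun _ : 𝓢(ℝ, ℝ) => ℝ)) := I.measurable_restrict
    have hm : Measurable fun ω : StrongDual ℝ 𝓢(ℝ, ℝ) => fun i : I => ω i :=
      measurable_pi_iff.2 fun i => measurable_dual_apply _
    have key : μ.map (fun ω => (WithLp.toLp 2 fun i : I => ω i : EuclideanSpace ℝ I))
        = ν.map (fun ω => WithLp.toLp 2 fun i : I => ω i) := by
      refine Measure.ext_of_charFun (funext fun t => ?_)
      rw [hfin μ hμ, hfin ν hν]
    have hL : Measurable fun ω : StrongDual ℝ 𝓢(ℝ, ℝ) =>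
        (WithLp.toLp 2 fun i : I => ω i : EuclideanSpace ℝ I) :=
      (WithLp.measurable_toLp 2 _).comp hm
    have hO : Measurable (WithLp.ofLp : EuclideanSpace ℝ I → I → ℝ) := WithLp.measurable_ofLp 2 _
    have key2 := congrArg (Measure.map (WithLp.ofLp : EuclideanSpace ℝ I → I → ℝ)) key
    rw [Measure.map_map hO hL, Measure.map_map hO hL] at key2
    change Measure.map I.restrict (Measure.map T ν) = Measure.map I.restrict (Measure.map T μ)
    rw [Measure.map_map hr hT, Measure.map_map hr hT]
    exact key2.symm
  ext s hs
  have hle : instMeasurableSpaceDual ≤ MeasurableSpace.comap T MeasurableSpace.pi := by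
    refine iSup_le fun φ => ?_
    rw [← BorelSpace.measurable_eq (α := ℝ), ← measurable_iff_comap_le]
    exact (measurable_pi_apply φ).comp (comap_measurable T)
  obtain ⟨A, hA, rfl⟩ := hle s hs
  rw [← Measure.map_apply hT hA, ← Measure.map_apply hT hA, hmap]

end MittagLeffler

end

/-!
For a single Schwartz function `φ`, the law of `⟨·, φ⟩` under `μ_β` is a probability measure on `ℝ`
with characteristic function `t ↦ E_β(-t² ⟨φ, φ⟩ / 2)`, which is given by a convergent power series
in `t` (`hasFPowerSeriesAt_mittagLefflerE`) because `Γ` outgrows every exponential. Analyticity at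
`0` forces all moments to be finite (`integrable_pow_of_hasFPowerSeriesAt_charFun`): the `2n`-th
central difference of the characteristic function with step `h` is, up to sign,
`∫ (2 sin (h x / 2)) ^ (2 n)`, it is `O(h ^ (2 n))`, and Fatou's lemma bounds `∫ x ^ (2 n)`. The
moments are then the derivatives of the characteristic function at `0` up to powers of `i`, hence
are read off from the series: the odd ones vanish, and the `2m`-th one is
`(2m)! (⟨φ, φ⟩ / 2) ^ m / Γ(β m + 1)`.

Under the product measure `⟨ω, φ⟩` is a sum of independent terms `⟨ω_k, φ_k⟩`. Expanding its powers
by the multinomial theorem and integrating factor by factor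
(`IsMittagLefflerMeasure.integral_productMeasure_pow`), only even exponents survive, and their
factorials cancel the multinomial coefficients. The covariance follows from the second moments by
polarization.
-/

namespace MittagLeffler

open Filter Topology Finset

/-! ### Finite differences -/

/-- The `N`-th finite difference annihilates polynomials of degree less than `N`. -/
theorem sum_alternating_choose_mul_sub_pow_eq_zero {N k : ℕ} (hk : k < N) (y : ℝ) :
    ∑ j ∈ range (N + 1), ((-1 : ℝ) ^ (N - j) * N.choose j) * (j - y) ^ k = 0 := by
  have h := congrFun (fwdDiff_iter_pow_eq_zero_of_lt (R := ℝ) hk) (-y)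
  rw [fwdDiff_iter_eq_sum_shift] at h
  simpa [zsmul_eq_mul, neg_add_eq_sub] using h

/-- The `N`-th finite difference with step `h` of a function analytic at `0` is `O(h ^ N)`: it kills
the Taylor polynomial of degree less than `N`, and the remainder is `O(h ^ N)` at each node. -/
theorem isBigO_centralDiff {f : ℝ → ℂ} {p : FormalMultilinearSeries ℝ ℝ ℂ}
    (hf : HasFPowerSeriesAt f p 0) (N : ℕ) (y : ℝ) :
    (fun h : ℝ => ∑ j ∈ range (N + 1),
      (((-1 : ℝ) ^ (N - j) * N.choose j : ℝ) : ℂ) * f ((j - y) * h)) =O[𝓝 0] fun h => ‖h‖ ^ N := by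
  have hO := hf.isBigO_sub_partialSum_pow N
  simp only [zero_add] at hO
  have heq : (fun h : ℝ => ∑ j ∈ range (N + 1),
      (((-1 : ℝ) ^ (N - j) * N.choose j : ℝ) : ℂ) * f ((j - y) * h))
      = fun h : ℝ => ∑ j ∈ range (N + 1), (((-1 : ℝ) ^ (N - j) * N.choose j : ℝ) : ℂ) *
        (f ((j - y) * h) - p.partialSum N ((j - y) * h)) := by
    funext h
    have hz : ∑ j ∈ range (N + 1), (((-1 : ℝ) ^ (N - j) * N.choose j : ℝ) : ℂ) *
        p.partialSum N ((j - y) * h) = 0 := by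
      simp only [FormalMultilinearSeries.partialSum,
        FormalMultilinearSeries.apply_eq_pow_smul_coeff, mul_sum]
      rw [sum_comm]
      refine sum_eq_zero fun k hk => ?_
      have := sum_alternating_choose_mul_sub_pow_eq_zero (mem_range.1 hk) y
      calc _ = ((∑ j ∈ range (N + 1), ((-1 : ℝ) ^ (N - j) * N.choose j) * (j - y) ^ k : ℝ) : ℂ)
            * ((h : ℂ) ^ k * p.coeff k) := by
            rw [Complex.ofReal_sum, sum_mul]
            refine sum_congr rfl fun j _ => ?_
            rw [Complex.real_smul]
            push_cast
            rw [mul_pow]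
            ring
        _ = 0 := by rw [this]; simp
    simp only [mul_sub, sum_sub_distrib, hz, sub_zero]
  rw [heq]
  have hterm : ∀ j ∈ range (N + 1), (fun h : ℝ => (((-1 : ℝ) ^ (N - j) * N.choose j : ℝ) : ℂ) *
      (f ((j - y) * h) - p.partialSum N ((j - y) * h))) =O[𝓝 0] fun h => ‖h‖ ^ N := by
    intro j _
    refine Asymptotics.IsBigO.const_mul_left ?_ _
    have ht : Tendsto (fun h : ℝ => ((j : ℝ) - y) * h) (𝓝 0) (𝓝 0) := by
      have : Continuous fun h : ℝ => ((j : ℝ) - y) * h := by fun_prop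
      simpa using this.tendsto 0
    refine (hO.comp_tendsto ht).trans ?_
    simp only [Function.comp_def, norm_mul, mul_pow]
    exact (Asymptotics.isBigO_refl _ _).const_mul_left _
  exact Asymptotics.IsBigO.fun_sum hterm

/-- The central difference of order `2 n` of `t ↦ exp (i t θ)` at `0` is
`(exp (i θ / 2) - exp (-i θ / 2)) ^ (2 n)`, a real number of constant sign. -/
theorem sum_alternating_choose_mul_cexp (n : ℕ) (θ : ℝ) :
    ∑ j ∈ range (2 * n + 1), (((-1 : ℝ) ^ (2 * n - j) * (2 * n).choose j : ℝ) : ℂ) *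
      Complex.exp (((j - n : ℝ) * θ : ℝ) * Complex.I)
      = (((-1) ^ n * (2 * Real.sin (θ / 2)) ^ (2 * n) : ℝ) : ℂ) := by
  set w := Complex.exp ((θ / 2 : ℝ) * Complex.I) with hw
  have hsin : w - w⁻¹ = 2 * Real.sin (θ / 2) * Complex.I := by
    rw [hw, ← Complex.exp_neg, Complex.ofReal_sin, Complex.sin]
    have : -((θ / 2 : ℝ) : ℂ) * Complex.I = -(((θ / 2 : ℝ) : ℂ) * Complex.I) := by ring
    rw [this]
    linear_combination (Complex.exp (((θ / 2 : ℝ) : ℂ) * Complex.I) -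
      Complex.exp (-(((θ / 2 : ℝ) : ℂ) * Complex.I))) * Complex.I_sq
  have hterm : ∀ j ∈ range (2 * n + 1), (((-1 : ℝ) ^ (2 * n - j) * (2 * n).choose j : ℝ) : ℂ) *
      Complex.exp (((j - n : ℝ) * θ : ℝ) * Complex.I)
      = w ^ j * (-w⁻¹) ^ (2 * n - j) * (2 * n).choose j := by
    intro j hj
    have hj' : j ≤ 2 * n := Nat.lt_succ_iff.1 (mem_range.1 hj)
    have : Complex.exp (((j - n : ℝ) * θ : ℝ) * Complex.I) = w ^ j * (w⁻¹) ^ (2 * n - j) := by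
      rw [hw, ← Complex.exp_neg, ← Complex.exp_nat_mul, ← Complex.exp_nat_mul, ← Complex.exp_add]
      congr 1
      push_cast [Nat.cast_sub hj']
      ring
    rw [this, neg_pow (w⁻¹)]
    push_cast
    ring
  rw [sum_congr rfl hterm, ← add_pow, ← sub_eq_add_neg, hsin, mul_pow, pow_mul Complex.I,
    Complex.I_sq]
  push_cast
  ring

/-! ### Moments from an analytic characteristic function -/

theorem integral_sin_pow_eq_centralDiff_charFun (ν : Measure ℝ) [IsFiniteMeasure ν] (n : ℕ)
    (h : ℝ) :
    ∑ j ∈ range (2 * n + 1), (((-1 : ℝ) ^ (2 * n - j) * (2 * n).choose j : ℝ) : ℂ) *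
      charFun ν ((j - n) * h)
      = (((-1) ^ n * ∫ x, (2 * Real.sin (h * x / 2)) ^ (2 * n) ∂ν : ℝ) : ℂ) := by
  rw [← integral_const_mul, ← integral_complex_ofReal]
  simp_rw [← sum_alternating_choose_mul_cexp]
  rw [integral_finsetSum]
  · refine sum_congr rfl fun j _ => ?_
    rw [charFun_apply_real, integral_const_mul]
    congr 1
    refine integral_congr_ae (Eventually.of_forall fun x => ?_)
    simp only
    congr 1
    push_cast
    ring
  · intro j _
    refine Integrable.const_mul ?_ _
    refine Integrable.of_bound (C := 1) (by fun_prop) (Eventually.of_forall fun x => ?_)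
    rw [Complex.norm_exp_ofReal_mul_I]

/-- A finite measure on `ℝ` whose characteristic function is analytic at `0` has finite even moments.
The integrals of `(2 sin (h x / 2) / h) ^ (2 n)` are, up to sign, normalised central differences of
the characteristic function, hence bounded as `h → 0`, and Fatou's lemma applies. -/
theorem integrable_pow_of_hasFPowerSeriesAt_charFun {ν : Measure ℝ} [IsFiniteMeasure ν]
    {p : FormalMultilinearSeries ℝ ℝ ℂ} (hp : HasFPowerSeriesAt (charFun ν) p 0) (n : ℕ) :
    Integrable (fun x : ℝ => x ^ (2 * n)) ν := by
  obtain ⟨C, hC⟩ := (isBigO_centralDiff hp (2 * n) n).bound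
  have hlim : Tendsto (fun m : ℕ => 1 / ((m : ℝ) + 1)) atTop (𝓝 0) :=
    tendsto_one_div_add_atTop_nhds_zero_nat
  refine integrable_of_tendsto
    (G := fun m x => (x * Real.sinc (1 / ((m : ℝ) + 1) * x / 2)) ^ (2 * n))
    (Eventually.of_forall fun x => ?_) (fun m => ?_) ?_
  · have hc : Continuous fun h : ℝ => (x * Real.sinc (h * x / 2)) ^ (2 * n) := by
      have := Real.continuous_sinc
      fun_prop
    simpa [Function.comp_def] using (hc.tendsto 0).comp hlim
  · have := Real.continuous_sinc
    exact Continuous.aestronglyMeasurable (by fun_prop)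
  · have hbound : ∀ᶠ m : ℕ in atTop,
        ∫⁻ x, ‖(x * Real.sinc (1 / ((m : ℝ) + 1) * x / 2)) ^ (2 * n)‖ₑ ∂ν
        ≤ ENNReal.ofReal C := by
      filter_upwards [hlim.eventually hC] with m hm
      set h : ℝ := 1 / ((m : ℝ) + 1)
      have h0 : 0 < h := by positivity
      -- For `h ≠ 0`, `x * sinc (h x / 2) = 2 sin (h x / 2) / h`; the left side extends
      -- continuously to `h = 0` with value `x`.
      have hsc : ∀ x : ℝ, (x * Real.sinc (h * x / 2)) ^ (2 * n)
          = (h ^ (2 * n))⁻¹ * (2 * Real.sin (h * x / 2)) ^ (2 * n) := by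
        intro x
        rcases eq_or_ne x 0 with rfl | hx
        · rcases Nat.eq_zero_or_pos n with rfl | hn
          · simp
          · simp [hn.ne']
        · rw [Real.sinc_of_ne_zero (by positivity), ← inv_pow, ← mul_pow]
          congr 1
          field_simp
      have hnn : ∀ x : ℝ, 0 ≤ (2 * Real.sin (h * x / 2)) ^ (2 * n) := fun x =>
        (even_two_mul n).pow_nonneg _
      have hint : Integrable (fun x => (h ^ (2 * n))⁻¹ * (2 * Real.sin (h * x / 2)) ^ (2 * n)) ν := by
        refine Integrable.const_mul ?_ _
        refine Integrable.of_bound (C := 2 ^ (2 * n))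
          (Continuous.aestronglyMeasurable (by fun_prop)) (Eventually.of_forall fun x => ?_)
        rw [norm_pow, norm_mul, Real.norm_ofNat, Real.norm_eq_abs]
        gcongr
        linarith [Real.abs_sin_le_one (h * x / 2)]
      simp_rw [hsc]
      rw [← ofReal_integral_norm_eq_lintegral_enorm hint]
      refine ENNReal.ofReal_le_ofReal ?_
      rw [integral_sin_pow_eq_centralDiff_charFun, Complex.norm_real, norm_mul, norm_pow, norm_neg,
        norm_one, one_pow, one_mul, Real.norm_of_nonneg (integral_nonneg hnn),
        Real.norm_of_nonneg (by positivity), Real.norm_of_nonneg h0.le] at hm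
      have : ∀ x : ℝ, ‖(h ^ (2 * n))⁻¹ * (2 * Real.sin (h * x / 2)) ^ (2 * n)‖
          = (h ^ (2 * n))⁻¹ * (2 * Real.sin (h * x / 2)) ^ (2 * n) := fun x =>
        Real.norm_of_nonneg (mul_nonneg (by positivity) (hnn x))
      simp_rw [this]
      rw [integral_const_mul, inv_mul_le_iff₀ (by positivity), mul_comm (h ^ (2 * n))]
      exact hm
    exact ((liminf_le_of_frequently_le' hbound.frequently).trans_lt ENNReal.ofReal_lt_top).ne

theorem memLp_id_of_hasFPowerSeriesAt_charFun {ν : Measure ℝ} [IsFiniteMeasure ν]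
    {p : FormalMultilinearSeries ℝ ℝ ℂ} (hp : HasFPowerSeriesAt (charFun ν) p 0) (n : ℕ) :
    MemLp id n ν := by
  rcases Nat.eq_zero_or_pos n with rfl | hn
  · simpa using aestronglyMeasurable_id
  have h2 : MemLp (id : ℝ → ℝ) ((2 * n : ℕ) : ENNReal) ν := by
    rw [← integrable_norm_rpow_iff aestronglyMeasurable_id (by exact_mod_cast (by omega))
      (ENNReal.natCast_ne_top _), ENNReal.toReal_natCast]
    simp only [Real.rpow_natCast]
    simpa [(even_two_mul n).pow_abs] using integrable_pow_of_hasFPowerSeriesAt_charFun hp n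
  exact h2.mono_exponent (by exact_mod_cast (by omega))

theorem integrable_pow_of_memLp_id {ν : Measure ℝ} [IsFiniteMeasure ν] {n : ℕ}
    (h : MemLp id n ν) : Integrable (fun x : ℝ => x ^ n) ν := by
  rw [← integrable_norm_iff (Continuous.aestronglyMeasurable (by fun_prop))]
  simpa using h.integrable_norm_pow'

theorem integral_pow_of_hasFPowerSeriesAt_charFun {ν : Measure ℝ} [IsFiniteMeasure ν]
    {p : FormalMultilinearSeries ℝ ℝ ℂ} (hp : HasFPowerSeriesAt (charFun ν) p 0) (n : ℕ) :
    Complex.I ^ n * ((∫ x, x ^ n ∂ν : ℝ) : ℂ) = n.factorial * p.coeff n := by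
  rw [← iteratedDeriv_charFun_zero (memLp_id_of_hasFPowerSeriesAt_charFun hp n)]
  obtain ⟨r, hr⟩ := hp
  have := hr.factorial_smul 1 n
  rw [iteratedDeriv, ← this, FormalMultilinearSeries.apply_eq_pow_smul_coeff]
  simp

/-! ### The Mittag-Leffler series -/

/-- Since `R` is arbitrary, `Γ (s + 1)` outgrows every exponential in `s`. The bound comes from
restricting Euler's integral to `(R, ∞)`. -/
theorem rpow_mul_exp_neg_le_Gamma {R s : ℝ} (hR : 0 < R) (hs : 0 ≤ s) :
    R ^ s * Real.exp (-R) ≤ Real.Gamma (s + 1) := by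
  have hint := Real.GammaIntegral_convergent (s := s + 1) (by linarith)
  rw [Real.Gamma_eq_integral (by linarith), ← integral_exp_neg_Ioi R, ← integral_const_mul]
  have hsub : Set.Ioi R ⊆ Set.Ioi (0 : ℝ) := Set.Ioi_subset_Ioi hR.le
  refine le_trans ?_ (setIntegral_mono_set hint ?_ hsub.eventuallyLE)
  · refine setIntegral_mono_on ((integrableOn_exp_neg_Ioi R).const_mul _) (hint.mono_set hsub)
      measurableSet_Ioi fun x hx => ?_
    rw [add_sub_cancel_right, mul_comm]
    have : R ^ s ≤ x ^ s := Real.rpow_le_rpow hR.le (le_of_lt hx) hs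
    gcongr
  · filter_upwards [ae_restrict_mem measurableSet_Ioi] with x hx
    have : (0 : ℝ) < x := hx
    simp only [Pi.zero_apply]
    positivity

theorem summable_mittagLefflerE {β : ℝ} (hβ : 0 < β) (z : ℂ) :
    Summable fun n : ℕ => z ^ n / ((Real.Gamma (β * n + 1) : ℝ) : ℂ) := by
  -- With this `R`, `R ^ (β n) = (2 (‖z‖ + 1)) ^ n`, so the series is dominated by a geometric one
  -- of ratio `1 / 2`.
  set R : ℝ := (2 * (‖z‖ + 1)) ^ β⁻¹
  have hb : 0 < 2 * (‖z‖ + 1) := by positivity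
  have hR : 0 < R := Real.rpow_pos_of_pos hb _
  have hRβ : R ^ β = 2 * (‖z‖ + 1) := Real.rpow_inv_rpow hb.le hβ.ne'
  refine Summable.of_norm_bounded (g := fun n : ℕ => Real.exp R * (1 / 2) ^ n)
    ((summable_geometric_of_lt_one (by norm_num) (by norm_num)).mul_left _) fun n => ?_
  have hG := rpow_mul_exp_neg_le_Gamma hR (s := β * n) (by positivity)
  rw [Real.rpow_mul hR.le, hRβ, Real.rpow_natCast] at hG
  have hpos : 0 < Real.Gamma (β * n + 1) := Real.Gamma_pos_of_pos (by positivity)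
  rw [norm_div, norm_pow, Complex.norm_real, Real.norm_of_nonneg hpos.le, div_le_iff₀ hpos]
  calc ‖z‖ ^ n ≤ (‖z‖ + 1) ^ n := by gcongr; linarith
    _ = Real.exp R * (1 / 2) ^ n * ((2 * (‖z‖ + 1)) ^ n * Real.exp (-R)) := by
        rw [Real.exp_neg, mul_pow, one_div, inv_pow]
        field_simp
    _ ≤ _ := by gcongr

/-- The coefficient of `t ^ k` in the expansion of `E_β(-c t² / 2)` at `0`, which has only even powers
of `t`. -/
noncomputable def mittagLefflerCoeff (β c : ℝ) (k : ℕ) : ℂ :=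
  if Even k then (-(c : ℂ) / 2) ^ (k / 2) / ((Real.Gamma (β * (k / 2 : ℕ) + 1) : ℝ) : ℂ) else 0

/-- The expansion of `E_β(-c t² / 2)` at `0` as a formal power series in the real variable `t`. -/
noncomputable def mittagLefflerSeries (β c : ℝ) : FormalMultilinearSeries ℝ ℝ ℂ :=
  fun k => ContinuousMultilinearMap.mkPiRing ℝ (Fin k) (mittagLefflerCoeff β c k)

theorem coeff_mittagLefflerSeries (β c : ℝ) (k : ℕ) :
    (mittagLefflerSeries β c).coeff k = mittagLefflerCoeff β c k := by
  simp [FormalMultilinearSeries.coeff, mittagLefflerSeries]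

theorem hasFPowerSeriesAt_mittagLefflerE {β : ℝ} (hβ : 0 < β) (c : ℝ) :
    HasFPowerSeriesAt (fun t : ℝ => mittagLefflerE β ((-(1 / 2) * (t ^ 2 * c) : ℝ) : ℂ))
      (mittagLefflerSeries β c) 0 := by
  rw [hasFPowerSeriesAt_iff]
  refine Eventually.of_forall fun t => ?_
  simp only [coeff_mittagLefflerSeries, zero_add]
  -- Only the even indices contribute.
  rw [← (mul_right_injective₀ (two_ne_zero (α := ℕ))).hasSum_iff]
  · convert! (summable_mittagLefflerE hβ ((-(1 / 2) * (t ^ 2 * c) : ℝ) : ℂ)).hasSum using 1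
    funext m
    simp only [Function.comp_apply, mittagLefflerCoeff, even_two_mul, if_true,
      Nat.mul_div_cancel_left m two_pos, Complex.real_smul]
    push_cast
    rw [mul_div_assoc', pow_mul, ← mul_pow]
    congr 2
    ring
  · intro k hk
    have : ¬ Even k := fun ⟨m, hm⟩ => hk ⟨m, by simp only; omega⟩
    simp [mittagLefflerCoeff, this]

/-! ### Moments of the Mittag-Leffler measure -/

theorem l2Inner_smul_smul (t : ℝ) (φ : 𝓢(ℝ, ℝ)) :
    l2Inner (t • φ) (t • φ) = t ^ 2 * l2Inner φ φ := by
  rw [l2Inner, l2Inner, ← integral_const_mul]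
  refine integral_congr_ae (Eventually.of_forall fun x => ?_)
  simp only [smul_apply, smul_eq_mul]
  ring

section OneDim
variable {β : ℝ} {μ : Measure (StrongDual ℝ 𝓢(ℝ, ℝ))}

theorem IsMittagLefflerMeasure.charFun_map_eval (hμ : IsMittagLefflerMeasure β μ) (φ : 𝓢(ℝ, ℝ)) :
    charFun (μ.map fun ω => ω φ)
      = fun t : ℝ => mittagLefflerE β ((-(1 / 2) * (t ^ 2 * l2Inner φ φ) : ℝ) : ℂ) := by
  funext t
  rw [charFun_apply_real, integral_map (measurable_dual_apply φ).aemeasurable (by fun_prop),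
    ← l2Inner_smul_smul, ← hμ.charFun_eq]
  refine integral_congr_ae (Eventually.of_forall fun ω => ?_)
  simp [mul_comm]

theorem IsMittagLefflerMeasure.hasFPowerSeriesAt_charFun (hμ : IsMittagLefflerMeasure β μ)
    (hβ : 0 < β) (φ : 𝓢(ℝ, ℝ)) :
    HasFPowerSeriesAt (charFun (μ.map fun ω => ω φ))
      (mittagLefflerSeries β (l2Inner φ φ)) 0 := by
  rw [hμ.charFun_map_eval]
  exact hasFPowerSeriesAt_mittagLefflerE hβ _

theorem IsMittagLefflerMeasure.integrable_eval_pow (hμ : IsMittagLefflerMeasure β μ)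
    (hβ : 0 < β) (φ : 𝓢(ℝ, ℝ)) (n : ℕ) : Integrable (fun ω => (ω φ) ^ n) μ := by
  have := hμ.isProbabilityMeasure
  have h := integrable_pow_of_memLp_id (n := n)
    (memLp_id_of_hasFPowerSeriesAt_charFun (hμ.hasFPowerSeriesAt_charFun hβ φ) n)
  exact h.comp_measurable (measurable_dual_apply φ)

/-- Comparison of the two expressions for the `n`-th derivative at `0` of the characteristic function
of `⟨·, φ⟩`: through the moments, and through the Mittag-Leffler series. -/
theorem IsMittagLefflerMeasure.I_pow_mul_integral_eval_pow (hμ : IsMittagLefflerMeasure β μ)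
    (hβ : 0 < β) (φ : 𝓢(ℝ, ℝ)) (n : ℕ) :
    Complex.I ^ n * ((∫ ω, (ω φ) ^ n ∂μ : ℝ) : ℂ)
      = n.factorial * mittagLefflerCoeff β (l2Inner φ φ) n := by
  have := hμ.isProbabilityMeasure
  have h := integral_pow_of_hasFPowerSeriesAt_charFun (hμ.hasFPowerSeriesAt_charFun hβ φ) n
  rw [integral_map (measurable_dual_apply φ).aemeasurable (by fun_prop)] at h
  rwa [coeff_mittagLefflerSeries] at h

theorem IsMittagLefflerMeasure.integral_eval_pow_of_odd (hμ : IsMittagLefflerMeasure β μ)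
    (hβ : 0 < β) (φ : 𝓢(ℝ, ℝ)) {n : ℕ} (hn : ¬ Even n) : ∫ ω, (ω φ) ^ n ∂μ = 0 := by
  have h := hμ.I_pow_mul_integral_eval_pow hβ φ n
  rw [mittagLefflerCoeff, if_neg hn, mul_zero] at h
  exact_mod_cast (mul_eq_zero.1 h).resolve_left (pow_ne_zero _ Complex.I_ne_zero)

theorem IsMittagLefflerMeasure.integral_eval_pow_two_mul (hμ : IsMittagLefflerMeasure β μ)
    (hβ : 0 < β) (φ : 𝓢(ℝ, ℝ)) (n : ℕ) :
    ∫ ω, (ω φ) ^ (2 * n) ∂μ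
      = (2 * n).factorial * ((l2Inner φ φ / 2) ^ n / Real.Gamma (β * n + 1)) := by
  have h := hμ.I_pow_mul_integral_eval_pow hβ φ (2 * n)
  rw [mittagLefflerCoeff, if_pos (even_two_mul n), pow_mul, Complex.I_sq,
    Nat.mul_div_cancel_left n two_pos, neg_div,
    neg_pow ((l2Inner φ φ : ℂ) / 2), mul_div_assoc, mul_left_comm] at h
  exact_mod_cast mul_left_cancel₀ (pow_ne_zero n (neg_ne_zero.2 one_ne_zero)) h

end OneDim

/-! ### Moments of the product measure -/

theorem measurable_dualVec_apply {d : ℕ} (φ : SchwartzVec d) :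
    Measurable fun ω : StrongDual ℝ (SchwartzVec d) => ω φ := by
  rw [BorelSpace.measurable_eq (α := ℝ)]
  exact (comap_measurable _).mono (le_iSup (fun φ : SchwartzVec d =>
    MeasurableSpace.comap (fun ω : StrongDual ℝ (SchwartzVec d) => ω φ) (borel ℝ)) φ) le_rfl

section Product
variable {β : ℝ} {μ : Measure (StrongDual ℝ 𝓢(ℝ, ℝ))} {d : ℕ}

theorem dualOfTuple_apply_pow (ω : Fin d → StrongDual ℝ 𝓢(ℝ, ℝ)) (φ : SchwartzVec d) (N : ℕ) :
    (dualOfTuple ω φ) ^ N = ∑ r ∈ piAntidiag (univ : Finset (Fin d)) N,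
      (Nat.multinomial univ r : ℝ) * ∏ k, (ω k (φ k)) ^ r k := by
  rw [dualOfTuple_apply, sum_pow_eq_sum_piAntidiag]

theorem IsMittagLefflerMeasure.integrable_prod_eval_pow (hμ : IsMittagLefflerMeasure β μ)
    (hβ : 0 < β) (φ : SchwartzVec d) (r : Fin d → ℕ) :
    Integrable (fun ω : Fin d → StrongDual ℝ 𝓢(ℝ, ℝ) => ∏ k, (ω k (φ k)) ^ r k)
      (Measure.pi fun _ => μ) := by
  have := hμ.isProbabilityMeasure
  exact Integrable.fintype_prod (f := fun k (ω : StrongDual ℝ 𝓢(ℝ, ℝ)) => (ω (φ k)) ^ r k)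
    fun k => hμ.integrable_eval_pow hβ (φ k) (r k)

theorem IsMittagLefflerMeasure.integrable_productMeasure_pow (hμ : IsMittagLefflerMeasure β μ)
    (hβ : 0 < β) (φ : SchwartzVec d) (N : ℕ) :
    Integrable (fun ω => (ω φ) ^ N) (productMeasure μ d) := by
  rw [productMeasure, integrable_map_measure
    ((measurable_dualVec_apply φ).pow_const N).aestronglyMeasurable
    measurable_dualOfTuple.aemeasurable]
  simp only [Function.comp_def, dualOfTuple_apply_pow]
  exact integrable_finsetSum _ fun r _ => (hμ.integrable_prod_eval_pow hβ φ r).const_mul _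

/-- By the multinomial theorem and Fubini's theorem, the moments under the product measure reduce to
those of the factors. -/
theorem IsMittagLefflerMeasure.integral_productMeasure_pow (hμ : IsMittagLefflerMeasure β μ)
    (hβ : 0 < β) (φ : SchwartzVec d) (N : ℕ) :
    ∫ ω, (ω φ) ^ N ∂(productMeasure μ d) = ∑ r ∈ piAntidiag (univ : Finset (Fin d)) N,
      (Nat.multinomial univ r : ℝ) * ∏ k, ∫ ω, (ω (φ k)) ^ r k ∂μ := by
  have := hμ.isProbabilityMeasure
  rw [productMeasure, integral_map measurable_dualOfTuple.aemeasurable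
    ((measurable_dualVec_apply φ).pow_const N).aestronglyMeasurable]
  simp only [dualOfTuple_apply_pow]
  rw [integral_finsetSum _ fun r _ => (hμ.integrable_prod_eval_pow hβ φ r).const_mul _]
  refine sum_congr rfl fun r _ => ?_
  rw [integral_const_mul,
    integral_fintype_prod_eq_prod (fun k (ω : StrongDual ℝ 𝓢(ℝ, ℝ)) => (ω (φ k)) ^ r k)]

theorem IsMittagLefflerMeasure.integral_productMeasure_odd (hμ : IsMittagLefflerMeasure β μ)
    (hβ : 0 < β) (φ : SchwartzVec d) (n : ℕ) :
    ∫ ω, (ω φ) ^ (2 * n + 1) ∂(productMeasure μ d) = 0 := by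
  rw [hμ.integral_productMeasure_pow hβ]
  refine sum_eq_zero fun r hr => ?_
  -- The exponents have odd sum, so one of them is odd and its factor vanishes.
  have hex : ∃ k, ¬ Even (r k) := by
    by_contra! hall
    have hsum := (mem_piAntidiag.1 hr).1
    have : Even (∑ k, r k) := even_sum _ fun k _ => hall k
    rw [hsum] at this
    exact (Nat.not_even_two_mul_add_one n) this
  obtain ⟨k, hk⟩ := hex
  rw [prod_eq_zero (mem_univ k) (hμ.integral_eval_pow_of_odd hβ (φ k) hk), mul_zero]

theorem IsMittagLefflerMeasure.integral_productMeasure_even (hμ : IsMittagLefflerMeasure β μ)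
    (hβ : 0 < β) (φ : SchwartzVec d) (n : ℕ) :
    ∫ ω, (ω φ) ^ (2 * n) ∂(productMeasure μ d)
      = ((2 * n).factorial : ℝ) / 2 ^ n * ∑ r ∈ piAntidiag (univ : Finset (Fin d)) n,
          (∏ k, l2Inner (φ k) (φ k) ^ (r k)) / ∏ k, Real.Gamma (β * (r k : ℝ) + 1) := by
  rw [hμ.integral_productMeasure_pow hβ, mul_sum]
  -- A term with some odd exponent vanishes; the others are indexed by the doubles of the
  -- tuples of sum `n`.
  have hfilter : ∑ r ∈ piAntidiag (univ : Finset (Fin d)) (2 * n),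
      (Nat.multinomial univ r : ℝ) * ∏ k, ∫ ω, (ω (φ k)) ^ r k ∂μ
      = ∑ r ∈ (piAntidiag (univ : Finset (Fin d)) n).map
          ⟨(2 • ·), nsmul_right_injective two_ne_zero⟩,
        (Nat.multinomial univ r : ℝ) * ∏ k, ∫ ω, (ω (φ k)) ^ r k ∂μ := by
    have hmem := Finset.ext_iff.1 (map_nsmul_piAntidiag_univ (ι := Fin d) n two_ne_zero)
    simp only [mem_filter] at hmem
    refine (sum_subset (fun r hr => ((hmem r).1 hr).1) fun r hr hr' => ?_).symm
    have hodd : ∃ k, ¬ 2 ∣ r k := by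
      by_contra! hall
      exact hr' ((hmem r).2 ⟨hr, hall⟩)
    obtain ⟨k, hk⟩ := hodd
    rw [prod_eq_zero (mem_univ k)
      (hμ.integral_eval_pow_of_odd hβ (φ k) (mt even_iff_two_dvd.1 hk)), mul_zero]
  rw [hfilter, sum_map]
  refine sum_congr rfl fun r hr => ?_
  have hsum : ∑ k, r k = n := (mem_piAntidiag.1 hr).1
  -- The factorials from the one-dimensional moments cancel the multinomial coefficient.
  have hmult : (∏ k, ((2 * r k).factorial : ℝ)) * (Nat.multinomial univ (2 • r) : ℝ)
      = (2 * n).factorial := by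
    have h := Nat.multinomial_spec univ (2 • r)
    simp only [Pi.smul_apply, smul_eq_mul, ← mul_sum, hsum] at h
    exact_mod_cast h
  have hpow : ∏ k, (2 : ℝ) ^ r k = 2 ^ n := by rw [prod_pow_eq_pow_sum, hsum]
  simp only [Function.Embedding.coeFn_mk, Pi.smul_apply, smul_eq_mul,
    hμ.integral_eval_pow_two_mul hβ, prod_mul_distrib, prod_div_distrib, div_pow, hpow]
  rw [← mul_assoc, mul_comm (Nat.multinomial _ _ : ℝ), hmult]
  ring

theorem IsMittagLefflerMeasure.integral_productMeasure_sq (hμ : IsMittagLefflerMeasure β μ)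
    (hβ : 0 < β) (φ : SchwartzVec d) :
    ∫ ω, (ω φ) ^ 2 ∂(productMeasure μ d) = 1 / Real.Gamma (β + 1) * l2InnerVec φ φ := by
  have h := hμ.integral_productMeasure_even hβ φ 1
  -- The tuples of sum `1` are the unit vectors.
  have hone : piAntidiag (univ : Finset (Fin d)) 1 = univ.image fun k => Pi.single k 1 := by
    ext r
    simp only [mem_piAntidiag, mem_univ, implies_true, and_true, mem_image, true_and]
    constructor
    · intro hr
      have hr' : ∑ k, r k = 1 := hr
      obtain ⟨k, -, hk⟩ := exists_ne_zero_of_sum_ne_zero (hr'.trans_ne one_ne_zero)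
      have hsplit : r k + ∑ j ∈ univ.erase k, r j = ∑ j, r j := add_sum_erase univ r (mem_univ k)
      have hrest : ∑ j ∈ univ.erase k, r j = 0 := by omega
      refine ⟨k, funext fun j => ?_⟩
      rcases eq_or_ne j k with rfl | hj
      · rw [Pi.single_eq_same]
        omega
      · rw [Pi.single_eq_of_ne hj]
        exact ((sum_eq_zero_iff.1 hrest) j (mem_erase.2 ⟨hj, mem_univ j⟩)).symm
    · rintro ⟨k, rfl⟩
      simp
  have hinj : Function.Injective fun k : Fin d => (Pi.single k 1 : Fin d → ℕ) := by
    intro a b hab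
    by_contra hne
    simpa [Pi.single_eq_of_ne hne] using congrFun hab a
  rw [hone, sum_image hinj.injOn, mul_one] at h
  rw [h, l2InnerVec, mul_sum, mul_sum]
  refine sum_congr rfl fun k _ => ?_
  rw [prod_eq_single k (fun j _ hj => by simp [Pi.single_eq_of_ne hj]) (by simp),
    prod_eq_single k (fun j _ hj => by simp [Pi.single_eq_of_ne hj]) (by simp)]
  simp [Nat.factorial]
  ring

/-! ### Second moments -/

theorem l2Inner_polarization (f g : 𝓢(ℝ, ℝ)) :
    l2Inner (f + g) (f + g) - l2Inner (f - g) (f - g) = 4 * l2Inner f g := by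
  -- Products of Schwartz functions are integrable, so the integrals may be subtracted.
  have hint : ∀ u v : 𝓢(ℝ, ℝ), Integrable (fun x => u x * v x) := fun u v =>
    (SchwartzMap.pairing (ContinuousLinearMap.mul ℝ ℝ) u v).integrable
  rw [l2Inner, l2Inner, l2Inner, ← integral_sub (hint _ _) (hint _ _), ← integral_const_mul]
  refine integral_congr_ae (Eventually.of_forall fun x => ?_)
  simp only [add_apply, sub_apply]
  ring

theorem l2InnerVec_polarization (φ ψ : SchwartzVec d) :
    l2InnerVec (φ + ψ) (φ + ψ) - l2InnerVec (φ - ψ) (φ - ψ) = 4 * l2InnerVec φ ψ := by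
  simp only [l2InnerVec, ← sum_sub_distrib, mul_sum, Pi.add_apply, Pi.sub_apply,
    l2Inner_polarization]

theorem l2NormVec_sq (φ : SchwartzVec d) : l2NormVec φ ^ 2 = l2InnerVec φ φ :=
  Real.sq_sqrt (sum_nonneg fun k _ => integral_nonneg fun x => mul_self_nonneg (φ k x))

theorem IsMittagLefflerMeasure.integrable_productMeasure_mul (hμ : IsMittagLefflerMeasure β μ)
    (hβ : 0 < β) (φ ψ : SchwartzVec d) :
    Integrable (fun ω => ω φ * ω ψ) (productMeasure μ d) ∧
      ∫ ω, ω φ * ω ψ ∂(productMeasure μ d) = 1 / Real.Gamma (β + 1) * l2InnerVec φ ψ := by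
  have hpol : (fun ω : StrongDual ℝ (SchwartzVec d) => ω φ * ω ψ)
      = fun ω => 4⁻¹ * ((ω (φ + ψ)) ^ 2 - (ω (φ - ψ)) ^ 2) := by
    funext ω
    rw [map_add, map_sub]
    ring
  have hadd := hμ.integrable_productMeasure_pow hβ (φ + ψ) 2
  have hsub := hμ.integrable_productMeasure_pow hβ (φ - ψ) 2
  rw [hpol]
  refine ⟨(hadd.sub hsub).const_mul _, ?_⟩
  rw [integral_const_mul, integral_sub hadd hsub, hμ.integral_productMeasure_sq hβ,
    hμ.integral_productMeasure_sq hβ, ← mul_sub, l2InnerVec_polarization]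
  ring

theorem IsMittagLefflerMeasure.memLp_two_productMeasure (hμ : IsMittagLefflerMeasure β μ)
    (hβ : 0 < β) (φ : SchwartzVec d) :
    MemLp (fun ω => ((ω φ : ℝ) : ℂ)) 2 (productMeasure μ d) := by
  have hm : AEStronglyMeasurable (fun ω : StrongDual ℝ (SchwartzVec d) => ((ω φ : ℝ) : ℂ))
      (productMeasure μ d) :=
    (Complex.measurable_ofReal.comp (measurable_dualVec_apply φ)).aestronglyMeasurable
  rw [memLp_two_iff_integrable_sq_norm hm]
  simpa using hμ.integrable_productMeasure_pow hβ φ 2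

theorem IsMittagLefflerMeasure.eLpNorm_two_productMeasure (hμ : IsMittagLefflerMeasure β μ)
    (hβ : 0 < β) (φ : SchwartzVec d) :
    (eLpNorm (fun ω => ((ω φ : ℝ) : ℂ)) 2 (productMeasure μ d)).toReal ^ 2
      = 1 / Real.Gamma (β + 1) * l2NormVec φ ^ 2 := by
  have hnn : 0 ≤ ∫ ω, (ω φ) ^ 2 ∂(productMeasure μ d) := integral_nonneg fun ω => sq_nonneg _
  rw [(hμ.memLp_two_productMeasure hβ φ).eLpNorm_eq_integral_rpow_norm two_ne_zero
    ENNReal.ofNat_ne_top, l2NormVec_sq, ← hμ.integral_productMeasure_sq hβ]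
  simp only [ENNReal.toReal_ofNat, Complex.norm_real, Real.rpow_two, Real.norm_eq_abs, sq_abs]
  rw [ENNReal.toReal_ofReal (by positivity)]
  exact_mod_cast Real.rpow_inv_natCast_pow hnn two_ne_zero

end Product

end MittagLeffler

theorem mainTheorem12 (β : ℝ) (hβ : 0 < β) (hβ1 : β ≤ 1)
    (μ : MeasureTheory.Measure (StrongDual ℝ 𝓢(ℝ, ℝ)))
    (hμ : MittagLeffler.IsMittagLefflerMeasure β μ) (d : ℕ) :
    (∀ (φ : MittagLeffler.SchwartzVec d) (n : ℕ),
      (MeasureTheory.Integrable (fun ω => (ω φ) ^ (2 * n + 1))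
          (MittagLeffler.productMeasure μ d) ∧
        ∫ ω, (ω φ) ^ (2 * n + 1) ∂(MittagLeffler.productMeasure μ d) = 0) ∧
      (MeasureTheory.Integrable (fun ω => (ω φ) ^ (2 * n))
          (MittagLeffler.productMeasure μ d) ∧
        ∫ ω, (ω φ) ^ (2 * n) ∂(MittagLeffler.productMeasure μ d)
          = ((2 * n).factorial : ℝ) / 2 ^ n *
            ∑ r ∈ Finset.piAntidiag (Finset.univ : Finset (Fin d)) n,
              (∏ k, MittagLeffler.l2Inner (φ k) (φ k) ^ (r k)) /
                ∏ k, Real.Gamma (β * (r k : ℝ) + 1))) ∧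
    (∀ φ : MittagLeffler.SchwartzVec d,
      MeasureTheory.MemLp (fun ω => ((ω φ : ℝ) : ℂ)) 2 (MittagLeffler.productMeasure μ d) ∧
      (MeasureTheory.eLpNorm (fun ω => ((ω φ : ℝ) : ℂ)) 2
          (MittagLeffler.productMeasure μ d)).toReal ^ 2
        = 1 / Real.Gamma (β + 1) * MittagLeffler.l2NormVec φ ^ 2) ∧
    (∀ φ ψ : MittagLeffler.SchwartzVec d,
      MeasureTheory.Integrable (fun ω => ω φ * ω ψ) (MittagLeffler.productMeasure μ d) ∧
      ∫ ω, ω φ * ω ψ ∂(MittagLeffler.productMeasure μ d)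
        = 1 / Real.Gamma (β + 1) * MittagLeffler.l2InnerVec φ ψ) := by
  refine ⟨fun φ n => ⟨⟨hμ.integrable_productMeasure_pow hβ φ _,
    hμ.integral_productMeasure_odd hβ φ n⟩, hμ.integrable_productMeasure_pow hβ φ _,
    hμ.integral_productMeasure_even hβ φ n⟩, fun φ => ⟨hμ.memLp_two_productMeasure hβ φ,
    hμ.eLpNorm_two_productMeasure hβ φ⟩, hμ.integrable_productMeasure_mul hβ⟩
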